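/- For integers $q\ge 2$ and $n\ge 0$ let $\Sigma_q^n$ be the set of words of length $n$ over the alphabet $\{0,\dots,q-1\}$. For $c\in\Sigma_q^n$ let $\mathrm{Ball}_{\mathsf I}^q(c,R)\subseteq\Sigma_q^{n+R}$ be the set of words obtained from $c$ by exactly $R$ insertions of single symbols; its size depends only on $q,n,R$ and equals $V_{\mathsf I}^q(n,R)=\sum_{i=0}^{R}\binom{n+R}{i}(q-1)^i$. A code $\mathcal C\subseteq\Sigma_q^n$ is an $R$-insertion-covering code if every $y\in\Sigma_q^{n+R}$ lies in $\mathrm{Ball}_{\mathsf I}^q(c,R)$ for some $c\in\mathcal C$. Let $K_{\mathsf I}^q(n,R)$ be the smallest cardinality of such a code and put $$\mu_{\mathsf I}^q(n,R)=\frac{K_{\mathsf I}^q(n,R)\,V_{\mathsf I}^q(n,R)}{q^{n+R}},\qquad \mu_{\mathsf I}^{q,*}(R)=\limsup_{n\to\infty}\mu_{\mathsf I}^q(n,R).$$ Theorem. (1) For all integers $R\ge 2$ and $q\ge 2$, the number $\mu_{\mathsf I}^{q,*}(1)$ is finite and $$\mu_{\mathsf I}^{q,*}(R)\le \mathrm e\,\bigl(R\log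 R+\sqrt{2R\log R}+1\bigr)\,\mu_{\mathsf I}^{q,*}(1),$$ where $\log$ is the natural logarithm. (2) Consequently, $R$-insertion-covering codes exist within a factor $O(R\log R)$ of the sphere-covering lower bound: there is a universal constant $K>0$ such that for all $R\ge2$ and $q\ge2$ and all sufficiently large $n$ (depending on $q$ and $R$) there is an $R$-insertion-covering code $\mathcal C\subseteq\Sigma_q^n$ with $$|\mathcal C|\le K\,R\log R\cdot\frac{q^{n+R}}{V_{\mathsf I}^q(n,R)}.$$ -/

import Mathlib

/-- `InsertsTo t x y`: the word `y` is obtained from the word `x` by exactly `t` successive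
insertions of a single symbol, at arbitrary positions. -/
inductive InsertsTo {α : Type} : ℕ → List α → List α → Prop
  | refl (x : List α) : InsertsTo 0 x x
  | insert {t : ℕ} {x : List α} (u : List α) (a : α) (v : List α) :
      InsertsTo t x (u ++ v) → InsertsTo (t + 1) x (u ++ a :: v)

theorem InsertsTo.cons {α : Type} {t : ℕ} {x y : List α} (a : α) (h : InsertsTo t x y) :
    InsertsTo t (a :: x) (a :: y) := by
  induction h with
  | refl x => exact InsertsTo.refl _
  | insert u b v _ ih => exact InsertsTo.insert (a :: u) b v ih

/-- Equivalently, `x` is a subsequence of `y` and `y` is longer by `t`. -/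
theorem insertsTo_iff {α : Type} {t : ℕ} {x y : List α} :
    InsertsTo t x y ↔ List.Sublist x y ∧ y.length = x.length + t := by
  constructor
  · intro h
    induction h with
    | refl x => exact ⟨List.Sublist.refl x, rfl⟩
    | insert u a v _ ih =>
      refine ⟨ih.1.trans ((List.Sublist.refl u).append (List.sublist_cons_self a v)), ?_⟩
      have := ih.2
      simp only [List.length_append, List.length_cons] at this ⊢
      omega
  · rintro ⟨h, hl⟩
    induction h generalizing t with
    | slnil =>
      obtain rfl : t = 0 := by simpa using hl.symm
      exact InsertsTo.refl _
    | cons a h ih =>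
      have hle := h.length_le
      simp only [List.length_cons] at hl
      obtain ⟨s, rfl⟩ : ∃ s, t = s + 1 := ⟨t - 1, by omega⟩
      exact InsertsTo.insert [] a _ (ih (by omega))
    | cons_cons a h ih =>
      simp only [List.length_cons] at hl
      exact (ih (by omega)).cons a

/-- Words of length `n` over the alphabet `{0, …, q - 1}`. -/
abbrev QWord (q n : ℕ) : Type := Fin n → Fin q

open Classical in
/-- The radius-`t` insertion ball: all words obtained from `x` by exactly `t` insertions. -/
noncomputable def insertionBall {q n : ℕ} (x : QWord q n) (t : ℕ) : Finset (QWord q (n + t)) :=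
  Finset.univ.filter fun y => InsertsTo t (List.ofFn x) (List.ofFn y)

/-- The common size of all radius-`t` insertion balls around words of length `n` over a `q`-ary
alphabet; see `card_insertionBall`. -/
def insertionBallSize (q n t : ℕ) : ℕ :=
  ∑ i ∈ Finset.range (t + 1), (n + t).choose i * (q - 1) ^ i

theorem cons_sublist_cons_iff_ite {α : Type} [DecidableEq α] {a b : α} {x y : List α} :
    List.Sublist (a :: x) (b :: y) ↔ List.Sublist (if b = a then x else a :: x) y := by
  by_cases hb : b = a
  · subst hb
    simp
  · rw [if_neg hb]
    constructor
    · intro h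
      cases h with
      | cons _ h => exact h
      | cons_cons _ h => exact absurd rfl hb
    · exact fun h => h.cons b

open Classical in
theorem card_supersequences {q : ℕ} (hq : 0 < q) (x : List (Fin q)) (m : ℕ) :
    (Finset.univ.filter fun y : QWord q m => List.Sublist x (List.ofFn y)).card
      = ∑ i ∈ Finset.range (m + 1 - x.length), m.choose i * (q - 1) ^ i := by
  induction m generalizing x with
  | zero =>
    cases x with
    | nil => simp
    | cons a x => simp
  | succ m ih =>
    cases x with
    | nil =>
      have h := (add_pow (q - 1) 1 (m + 1)).symm
      rw [Nat.sub_add_cancel hq] at h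
      simp only [one_pow, mul_one] at h
      simp only [List.nil_sublist, Finset.filter_true, Finset.card_univ, Fintype.card_fun,
        Fintype.card_fin, List.length_nil, Nat.sub_zero]
      rw [← h]
      exact Finset.sum_congr rfl fun i _ => by simp [mul_comm]
    | cons a x =>
      have key : (Finset.univ.filter fun y : QWord q (m + 1) =>
            List.Sublist (a :: x) (List.ofFn y)).card
          = ∑ b : Fin q, (Finset.univ.filter fun y : QWord q m =>
              List.Sublist (if b = a then x else a :: x) (List.ofFn y)).card := by
        rw [← Fintype.card_subtype]
        simp only [← Fintype.card_subtype]
        rw [← Fintype.card_sigma]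
        refine Fintype.card_congr
          { toFun := fun y => ⟨y.1 0, ⟨Fin.tail y.1, ?_⟩⟩
            invFun := fun p => ⟨Fin.cons p.1 p.2.1, ?_⟩
            left_inv := ?_
            right_inv := ?_ }
        · have h := y.2
          rw [List.ofFn_succ] at h
          exact cons_sublist_cons_iff_ite.1 h
        · have h := p.2.2
          rw [List.ofFn_succ]
          simp only [Fin.cons_zero, Fin.cons_succ]
          exact cons_sublist_cons_iff_ite.2 h
        · intro y
          simp
        · intro p
          rfl
      rw [key, ← Finset.add_sum_erase _ _ (Finset.mem_univ a), if_pos rfl, ih x]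
      rw [Finset.sum_congr (s₁ := Finset.univ.erase a) rfl (g := fun _ =>
        ∑ i ∈ Finset.range (m + 1 - (a :: x).length), m.choose i * (q - 1) ^ i)
        (fun b hb => by rw [if_neg (Finset.ne_of_mem_erase hb), ih (a :: x)])]
      rw [Finset.sum_const, Finset.card_erase_of_mem (Finset.mem_univ a), Finset.card_univ,
        Fintype.card_fin, smul_eq_mul, List.length_cons]
      by_cases hx : x.length ≤ m
      · obtain ⟨k, rfl⟩ : ∃ k, m = x.length + k := ⟨m - x.length, by omega⟩
        have e1 : x.length + k + 1 - x.length = k + 1 := by omega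
        have e2 : x.length + k + 1 - (x.length + 1) = k := by omega
        have e3 : x.length + k + 1 + 1 - (x.length + 1) = k + 1 := by omega
        rw [e1, e2, e3, Finset.sum_range_succ' _ k, Finset.sum_range_succ' _ k, Finset.mul_sum,
          add_right_comm, ← Finset.sum_add_distrib]
        congr 1
        swap
        · simp
        refine Finset.sum_congr rfl fun i _ => ?_
        rw [Nat.choose_succ_succ]
        ring
      · have e1 : m + 1 - x.length = 0 := by omega
        have e2 : m + 1 - (x.length + 1) = 0 := by omega
        have e3 : m + 1 + 1 - (x.length + 1) = 0 := by omega
        rw [e1, e2, e3]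
        simp

/-- Insertion balls are regular: their size depends only on the length of the center. -/
theorem card_insertionBall {q n : ℕ} (hq : 0 < q) (x : QWord q n) (t : ℕ) :
    (insertionBall x t).card = insertionBallSize q n t := by
  have h := card_supersequences hq (List.ofFn x) (n + t)
  have e : n + t + 1 - (List.ofFn x).length = t + 1 := by
    rw [List.length_ofFn]; omega
  rw [e] at h
  rw [insertionBallSize, ← h, insertionBall]
  congr 1
  ext y
  simp [insertsTo_iff]

/-- `C` is an `R`-insertion-covering code: every word of length `n + R` lies in the radius-`R`
insertion ball of some codeword. -/
def IsInsertionCoveringCode {q n : ℕ} (R : ℕ) (C : Finset (QWord q n)) : Prop :=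
  ∀ y : QWord q (n + R), ∃ c ∈ C, y ∈ insertionBall c R

/-- The smallest cardinality of an `R`-insertion-covering code of length `n`. -/
noncomputable def minInsertionCovering (q n R : ℕ) : ℕ :=
  sInf {k : ℕ | ∃ C : Finset (QWord q n), IsInsertionCoveringCode R C ∧ C.card = k}

/-- The set of all words is a covering code, so the infimum above is a minimum. -/
theorem isInsertionCoveringCode_univ (q n R : ℕ) :
    IsInsertionCoveringCode R (Finset.univ : Finset (QWord q n)) := by
  intro y
  refine ⟨fun i => y (Fin.castAdd R i), Finset.mem_univ _, ?_⟩
  simp only [insertionBall, Finset.mem_filter, Finset.mem_univ, true_and, insertsTo_iff,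
    List.length_ofFn, and_true]
  rw [List.ofFn_add]
  exact List.sublist_append_left _ _

/-- The sphere-covering lower bound on the size of an `R`-insertion-covering code. -/
noncomputable def insertionSphereCoveringBound (q n R : ℕ) : ℝ :=
  (q : ℝ) ^ (n + R) / (insertionBallSize q n R : ℝ)

/-- The optimal density of `R`-insertion-covering codes of length `n`. -/
noncomputable def insertionDensity (q n R : ℕ) : ℝ :=
  (minInsertionCovering q n R : ℝ) * (insertionBallSize q n R : ℝ) / (q : ℝ) ^ (n + R)

/-- The asymptotic optimal density, the upper limit of the (nonnegative) optimal densities as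
`n → ∞`. It is formed in `[0, ∞]`, where every upper limit has its usual meaning. -/
noncomputable def asymptoticInsertionDensity (q R : ℕ) : ENNReal :=
  Filter.limsup (fun n : ℕ => ENNReal.ofReal (insertionDensity q n R)) Filter.atTop

open Filter Topology

/-! The bound comes from a random partial code repaired recursively on a shorter block. Write the
length as `m + R + k`. Choose a random set `A` of words of length `m` with density `μ`, that is,
with probability `μ q^R / V(m, R)` for each word. A received word is split after `m + R` symbols. If
its prefix contains a word of `A`, all `R` deletions are made there and the other `k + R` symbols
are kept; otherwise the prefix is kept whole and an optimal code of length `k` handles the rest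
(`minInsertionCovering_add_le`).

A prefix is missed with probability `(1 - p)^D`, where `D` counts its subsequences of length `m`.
With `c` changes of symbol, `D` is at least about `c^R / R!` (`choose_le_card_deletionSphere`), and
`c` concentrates at `(1 - 1/q) m`. Hence `p D` is at least about `μ` for almost all prefixes, and a
fraction of at most about `exp (-μ)` is missed.

Taking `k` close to `n / (R + 1)`, the density `d` satisfies, up to vanishing errors, `d n ≤ μ
((R+1)/R)^R + exp (-μ) (R+1)^R d k`, a contraction once `μ` exceeds `R log (R + 1)`. Its fixed
point, for `μ` slightly above that value, is at most `e (R log R + √(2 R log R) + 1)`. This bound is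
absolute; the factor for radius one is harmless because every density is at least one. -/

/-! ### Words as lists, and completion of partial codes -/

theorem injective_uncurry_cons (α : Type*) :
    Function.Injective fun p : α × List α => p.1 :: p.2 := fun p p' h => by
  simp only [List.cons.injEq] at h
  exact Prod.ext h.1 h.2

/-- The lists of length `n` over the alphabet `{0, …, q - 1}`. -/
def words (q : ℕ) : ℕ → Finset (List (Fin q))
  | 0 => {[]}
  | n + 1 => (Finset.univ ×ˢ words q n).map ⟨_, injective_uncurry_cons (Fin q)⟩

theorem mem_words {q n : ℕ} {l : List (Fin q)} : l ∈ words q n ↔ l.length = n := by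
  induction n generalizing l with
  | zero => simp [words]
  | succ n ih =>
    cases l with
    | nil => simp [words]
    | cons a l => simp [words, ih]

theorem sum_words_succ {q n : ℕ} {M : Type*} [AddCommMonoid M] (f : List (Fin q) → M) :
    ∑ l ∈ words q (n + 1), f l = ∑ a, ∑ l ∈ words q n, f (a :: l) := by
  rw [words, Finset.sum_map, Finset.sum_product]
  rfl

theorem card_words (q n : ℕ) : (words q n).card = q ^ n := by
  induction n with
  | zero => simp [words]
  | succ n ih => simp [words, ih, pow_succ, mul_comm]

/-- A covering code given as a set of lists bounds the optimal size of a covering code. -/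
theorem minInsertionCovering_le {q n R : ℕ} {C : Finset (List (Fin q))}
    (hlen : ∀ c ∈ C, c.length = n) (hC : ∀ y ∈ words q (n + R), ∃ c ∈ C, List.Sublist c y) :
    minInsertionCovering q n R ≤ C.card := by
  classical
  have hcard : (Finset.univ.filter fun x : QWord q n => List.ofFn x ∈ C).card ≤ C.card :=
    Finset.card_le_card_of_injOn List.ofFn (fun x hx => by simpa using hx)
      (List.ofFn_injective.injOn)
  refine le_trans (Nat.sInf_le ⟨_, ?_, rfl⟩) hcard
  intro y
  obtain ⟨c, hc, hcy⟩ := hC (List.ofFn y) (mem_words.2 (by simp))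
  have hl := hlen c hc
  subst hl
  refine ⟨c.get, ?_, ?_⟩
  · simpa using hc
  · simp [insertionBall, insertsTo_iff, hcy]

theorem exists_code_card_eq_minInsertionCovering (q n R : ℕ) :
    ∃ C : Finset (QWord q n), IsInsertionCoveringCode R C ∧
      C.card = minInsertionCovering q n R :=
  Nat.sInf_mem (s := {k : ℕ | ∃ C : Finset (QWord q n), IsInsertionCoveringCode R C ∧ C.card = k})
    ⟨_, Finset.univ, isInsertionCoveringCode_univ q n R, rfl⟩

theorem exists_list_code (q n R : ℕ) :
    ∃ C : Finset (List (Fin q)), (∀ c ∈ C, c.length = n) ∧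
      (∀ y ∈ words q (n + R), ∃ c ∈ C, List.Sublist c y) ∧
      C.card = minInsertionCovering q n R := by
  classical
  obtain ⟨C, hC, hcard⟩ := exists_code_card_eq_minInsertionCovering q n R
  refine ⟨C.image List.ofFn, ?_, ?_, ?_⟩
  · intro c hc
    obtain ⟨x, -, rfl⟩ := Finset.mem_image.1 hc
    simp
  · intro y hy
    obtain ⟨c, hc, hcy⟩ := hC fun i => y.get (i.cast (mem_words.1 hy).symm)
    refine ⟨_, Finset.mem_image_of_mem _ hc, ?_⟩
    have h := mem_words.1 hy
    simp only [insertionBall, Finset.mem_filter, Finset.mem_univ, true_and, insertsTo_iff] at hcy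
    have e : List.ofFn (fun i : Fin (n + R) => y.get (i.cast h.symm)) = y := by
      apply List.ext_get
      · simp [h]
      · intro i h1 h2
        simp
    rw [e] at hcy
    exact hcy.1
  · rw [Finset.card_image_of_injective _ List.ofFn_injective, hcard]

/-- A partial covering code on the first part of the words, completed on the last part. -/
theorem minInsertionCovering_add_le {q R : ℕ} (n k : ℕ) {A : Finset (List (Fin q))}
    (hA : A ⊆ words q n) :
    minInsertionCovering q (n + R + k) R ≤ A.card * q ^ (k + R) +
      ((words q (n + R)).filter fun y => ∀ c ∈ A, ¬ List.Sublist c y).card *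
        minInsertionCovering q k R := by
  classical
  obtain ⟨C, hlen, hC, hcard⟩ := exists_list_code q k R
  set U := (words q (n + R)).filter fun y => ∀ c ∈ A, ¬ List.Sublist c y with hU
  -- Covered prefixes absorb all `R` deletions and leave the tail free; uncovered ones are kept
  -- whole and the deletions fall in the tail.
  refine le_trans (minInsertionCovering_le (C :=
    (A ×ˢ words q (k + R)).image (fun p => p.1 ++ p.2) ∪ (U ×ˢ C).image fun p => p.1 ++ p.2)
    ?_ ?_) ?_
  · intro c hc
    simp only [Finset.mem_union, Finset.mem_image, Finset.mem_product, Prod.exists] at hc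
    rcases hc with ⟨a, b, ⟨ha, hb⟩, rfl⟩ | ⟨a, b, ⟨ha, hb⟩, rfl⟩
    · have h1 := mem_words.1 (hA ha)
      have h2 := mem_words.1 hb
      simp only [List.length_append]
      omega
    · have h1 := mem_words.1 (Finset.mem_filter.1 ha).1
      have h2 := hlen b hb
      simp only [List.length_append]
      omega
  · intro y hy
    have hy := mem_words.1 hy
    have h1 : y.take (n + R) ∈ words q (n + R) := mem_words.2 (by simp; omega)
    have h2 : y.drop (n + R) ∈ words q (k + R) := mem_words.2 (by simp; omega)
    by_cases h : y.take (n + R) ∈ U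
    · obtain ⟨c, hc, hcy⟩ := hC _ h2
      refine ⟨y.take (n + R) ++ c, Finset.mem_union_right _
        (Finset.mem_image.2 ⟨(_, c), Finset.mem_product.2 ⟨h, hc⟩, rfl⟩), ?_⟩
      conv_rhs => rw [← List.take_append_drop (n + R) y]
      exact (List.Sublist.refl _).append hcy
    · simp only [hU, Finset.mem_filter, h1, true_and] at h
      push Not at h
      obtain ⟨c, hc, hcy⟩ := h
      refine ⟨c ++ y.drop (n + R), Finset.mem_union_left _
        (Finset.mem_image.2 ⟨(c, _), Finset.mem_product.2 ⟨hc, h2⟩, rfl⟩), ?_⟩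
      conv_rhs => rw [← List.take_append_drop (n + R) y]
      exact hcy.append (List.Sublist.refl _)
  · refine le_trans (Finset.card_union_le _ _) (add_le_add ?_ ?_)
    · refine le_trans Finset.card_image_le ?_
      rw [Finset.card_product, card_words]
    · refine le_trans Finset.card_image_le ?_
      rw [Finset.card_product, hcard]

/-! ### The first moment method -/

/-- A random set avoiding `D` is a random subset of `S \ D`, of total mass one, times the factor `1
- p` for each excluded element. -/
theorem sum_powerset_disjoint {X : Type*} [DecidableEq X] (S : Finset X) {D : Finset X}
    (hD : D ⊆ S) (p : ℝ) :
    ∑ A ∈ S.powerset, (if Disjoint D A then p ^ A.card * (1 - p) ^ (S.card - A.card) else 0)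
      = (1 - p) ^ D.card := by
  have h : S.powerset.filter (fun A => Disjoint D A) = (S \ D).powerset := by
    ext A
    simp only [Finset.mem_filter, Finset.mem_powerset, Finset.subset_sdiff]
    tauto
  rw [← Finset.sum_filter, h]
  have h2 := Finset.sum_pow_mul_eq_add_pow p (1 - p) (S \ D)
  have hc := Finset.card_sdiff_add_card_eq_card hD
  calc _ = ∑ A ∈ (S \ D).powerset, (1 - p) ^ D.card *
        (p ^ A.card * (1 - p) ^ ((S \ D).card - A.card)) := by
        refine Finset.sum_congr rfl fun A hA => ?_
        have := Finset.card_le_card (Finset.mem_powerset.1 hA)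
        rw [show S.card - A.card = D.card + ((S \ D).card - A.card) by omega, pow_add]
        ring
    _ = _ := by rw [← Finset.mul_sum, h2]; simp

/-- The first moment method for a random set containing each element independently with
probability `p`. -/
theorem exists_partial_cover {X Y : Type*} [DecidableEq X] (S : Finset X) (T : Finset Y)
    (D : Y → Finset X) (hD : ∀ y ∈ T, D y ⊆ S) {p : ℝ} (h0 : 0 ≤ p) (h1 : p ≤ 1) (v w : ℝ) :
    ∃ A ⊆ S, v * A.card + w * (T.filter fun y => Disjoint (D y) A).card
      ≤ v * (p * S.card) + w * ∑ y ∈ T, (1 - p) ^ (D y).card := by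
  set P : Finset X → ℝ := fun A => p ^ A.card * (1 - p) ^ (S.card - A.card) with hP
  have hpos : ∀ A, 0 ≤ P A := fun A => mul_nonneg (pow_nonneg h0 _) (pow_nonneg (by linarith) _)
  have hsum : ∑ A ∈ S.powerset, P A = 1 := by
    rw [Finset.sum_pow_mul_eq_add_pow]; simp
  have hU : ∑ A ∈ S.powerset, P A * ((T.filter fun y => Disjoint (D y) A).card : ℝ)
      = ∑ y ∈ T, (1 - p) ^ (D y).card := by
    rw [← Finset.sum_congr rfl fun y hy => sum_powerset_disjoint S (hD y hy) p,
      Finset.sum_comm]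
    refine Finset.sum_congr rfl fun A _ => ?_
    rw [Finset.card_filter, Nat.cast_sum, Finset.mul_sum]
    exact Finset.sum_congr rfl fun y _ => by split_ifs <;> simp [hP]
  have hA : ∑ A ∈ S.powerset, P A * (A.card : ℝ) = p * S.card := by
    -- The cardinality is a sum of indicators, and `x ∈ A` is the complement of avoiding `{x}`.
    have e : ∀ A ∈ S.powerset, P A * (A.card : ℝ)
        = ∑ x ∈ S, (P A - if Disjoint {x} A then P A else 0) := by
      intro A hA
      have : A = S.filter fun x => x ∈ A := by
        ext x
        simp only [Finset.mem_filter]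
        exact ⟨fun h => ⟨Finset.mem_powerset.1 hA h, h⟩, fun h => h.2⟩
      conv_lhs => rw [show (A.card : ℝ) = ((S.filter fun x => x ∈ A).card : ℝ) by rw [← this]]
      rw [Finset.card_filter, Nat.cast_sum, Finset.mul_sum]
      exact Finset.sum_congr rfl fun x _ => by by_cases h : x ∈ A <;> simp [h]
    rw [Finset.sum_congr rfl e, Finset.sum_comm]
    have e2 : ∀ x ∈ S, ∑ A ∈ S.powerset, (P A - if Disjoint {x} A then P A else 0) = p := by
      intro x hx
      rw [Finset.sum_sub_distrib, hsum,
        sum_powerset_disjoint S (Finset.singleton_subset_iff.2 hx) p]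
      simp
    rw [Finset.sum_congr rfl e2]
    simp [mul_comm]
  -- If every `A` exceeded the claimed value, so would the weighted mean, which equals it.
  by_contra! hcon
  have hlt : ∑ A ∈ S.powerset, P A * (v * (p * S.card) + w * ∑ y ∈ T, (1 - p) ^ (D y).card)
      < ∑ A ∈ S.powerset, P A * (v * A.card + w * (T.filter fun y => Disjoint (D y) A).card) := by
    obtain ⟨A, hA, hne⟩ : ∃ A ∈ S.powerset, P A ≠ 0 := by
      by_contra! h
      rw [Finset.sum_eq_zero h] at hsum
      exact zero_ne_one hsum
    refine Finset.sum_lt_sum (fun B hB => mul_le_mul_of_nonneg_left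
      (hcon B (Finset.mem_powerset.1 hB)).le (hpos B)) ⟨A, hA, ?_⟩
    exact mul_lt_mul_of_pos_left (hcon A (Finset.mem_powerset.1 hA))
      (lt_of_le_of_ne (hpos A) (Ne.symm hne))
  rw [← Finset.sum_mul, hsum, one_mul] at hlt
  refine lt_irrefl _ (lt_of_lt_of_eq hlt ?_)
  rw [← hA, ← hU, Finset.mul_sum, Finset.mul_sum, ← Finset.sum_add_distrib]
  exact Finset.sum_congr rfl fun A _ => by ring

/-! ### Counting subsequences through changes of symbol -/

/-- The words obtained from `y` by `t` deletions. -/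
def deletionSphere {q : ℕ} (t : ℕ) (y : List (Fin q)) : Finset (List (Fin q)) :=
  (y.sublistsLen (y.length - t)).toFinset

theorem mem_deletionSphere {q t : ℕ} {x y : List (Fin q)} :
    x ∈ deletionSphere t y ↔ List.Sublist x y ∧ x.length = y.length - t := by
  simp [deletionSphere]

theorem minInsertionCovering_add_le_sum {q R : ℕ} (n k : ℕ) {p : ℝ} (h0 : 0 ≤ p) (h1 : p ≤ 1) :
    (minInsertionCovering q (n + R + k) R : ℝ) ≤ q ^ (k + R) * (p * q ^ n) +
      minInsertionCovering q k R *
        ∑ y ∈ words q (n + R), (1 - p) ^ (deletionSphere R y).card := by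
  classical
  obtain ⟨A, hA, h⟩ := exists_partial_cover (words q n) (words q (n + R)) (deletionSphere R)
    (fun y hy x hx => by
      have h1 := (mem_deletionSphere.1 hx).2
      rw [mem_words.1 hy] at h1
      exact mem_words.2 (by omega)) h0 h1 (q ^ (k + R)) (minInsertionCovering q k R)
  rw [card_words, Nat.cast_pow] at h
  refine le_trans ?_ h
  have h2 := minInsertionCovering_add_le (R := R) n k hA
  have e : ((words q (n + R)).filter fun y => ∀ c ∈ A, ¬ List.Sublist c y)
      = (words q (n + R)).filter fun y => Disjoint (deletionSphere R y) A := by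
    refine Finset.filter_congr fun y hy => ?_
    rw [Finset.disjoint_right]
    refine forall₂_congr fun c hc => not_congr ?_
    rw [mem_deletionSphere, mem_words.1 hy, mem_words.1 (hA hc)]
    simp
  rw [e] at h2
  refine le_trans (Nat.cast_le.2 h2) (le_of_eq ?_)
  push_cast
  ring

/-- The number of adjacent pairs of distinct symbols. -/
def changes {q : ℕ} : List (Fin q) → ℕ
  | [] => 0
  | [_] => 0
  | a :: b :: l => (if a = b then 0 else 1) + changes (b :: l)

theorem changes_cons_le {q : ℕ} (a : Fin q) (l : List (Fin q)) :
    changes (a :: l) ≤ changes l + 1 := by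
  cases l with
  | nil => simp [changes]
  | cons b l => simp only [changes]; split_ifs <;> omega

/-- Pascal's rule drives the induction. If `a ≠ b`, the subsequences of `a :: b :: l` that keep `a`
and those that delete it and keep `b` are disjoint, and passing from `b :: l` to `l` loses at most
one change. If `a = b`, keeping `a` already suffices. -/
theorem choose_le_card_deletionSphere {q : ℕ} : ∀ (l : List (Fin q)) (t : ℕ), t ≤ l.length →
    (changes l + 2 - t).choose t ≤ (deletionSphere t l).card
  | [], t, ht => by
    obtain rfl : t = 0 := by simpa using ht
    simp [deletionSphere]
  | [a], t, ht => by
    simp only [List.length_singleton] at ht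
    interval_cases t <;> simp [changes, deletionSphere]
  | a :: b :: l, 0, _ => by simp [deletionSphere]
  | a :: b :: l, t + 1, ht => by
    classical
    simp only [List.length_cons] at ht
    by_cases hlt : t + 1 ≤ (b :: l).length
    swap
    · have hl : l.length + 1 = t := by simp only [List.length_cons] at hlt; omega
      have h1 : changes (a :: b :: l) ≤ l.length + 1 := by
        have key : ∀ (m : List (Fin q)) (c : Fin q), changes (c :: m) ≤ m.length := by
          intro m
          induction m with
          | nil => intro c; simp [changes]
          | cons d m ih =>
            intro c
            have := ih d
            simp only [changes, List.length_cons]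
            split_ifs <;> omega
        simpa using key (b :: l) a
      have h2 : (changes (a :: b :: l) + 2 - (t + 1)).choose (t + 1) ≤ 1 := by
        refine le_trans (Nat.choose_le_choose (t + 1) (show _ ≤ t + 1 by omega)) (by simp)
      refine le_trans h2 (Finset.card_pos.2 ⟨[], mem_deletionSphere.2 ⟨by simp, ?_⟩⟩)
      simp only [List.length_cons, List.length_nil]
      omega
    have ih1 := choose_le_card_deletionSphere (b :: l) (t + 1) hlt
    have hsub1 : (deletionSphere (t + 1) (b :: l)).image (List.cons a)
        ⊆ deletionSphere (t + 1) (a :: b :: l) := by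
      intro x hx
      obtain ⟨z, hz, rfl⟩ := Finset.mem_image.1 hx
      obtain ⟨h1, h2⟩ := mem_deletionSphere.1 hz
      refine mem_deletionSphere.2 ⟨h1.cons_cons a, ?_⟩
      simp only [List.length_cons] at h2 hlt ⊢
      omega
    have hc1 : ((deletionSphere (t + 1) (b :: l)).image (List.cons a)).card
        = (deletionSphere (t + 1) (b :: l)).card :=
      Finset.card_image_of_injective _ (List.cons_injective)
    by_cases hab : a = b
    · have e : changes (a :: b :: l) = changes (b :: l) := by simp [changes, hab]
      rw [e]
      exact le_trans ih1 (hc1 ▸ Finset.card_le_card hsub1)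
    · have e : changes (a :: b :: l) = changes (b :: l) + 1 := by simp [changes, hab, add_comm]
      have hle := changes_cons_le b l
      simp only [List.length_cons] at hlt
      have ih2 := choose_le_card_deletionSphere l t (by omega)
      have hsub2 : (deletionSphere t l).image (List.cons b)
          ⊆ deletionSphere (t + 1) (a :: b :: l) := by
        intro x hx
        obtain ⟨z, hz, rfl⟩ := Finset.mem_image.1 hx
        obtain ⟨h1, h2⟩ := mem_deletionSphere.1 hz
        refine mem_deletionSphere.2 ⟨(h1.cons_cons b).cons a, ?_⟩
        simp only [List.length_cons] at h2 ⊢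
        omega
      have hc2 : ((deletionSphere t l).image (List.cons b)).card = (deletionSphere t l).card :=
        Finset.card_image_of_injective _ (List.cons_injective)
      have hdisj : Disjoint ((deletionSphere (t + 1) (b :: l)).image (List.cons a))
          ((deletionSphere t l).image (List.cons b)) := by
        rw [Finset.disjoint_left]
        intro x hx hx'
        obtain ⟨z, -, rfl⟩ := Finset.mem_image.1 hx
        obtain ⟨z', -, h⟩ := Finset.mem_image.1 hx'
        exact hab (List.cons.inj h).1.symm
      have hcard := Finset.card_le_card (Finset.union_subset hsub1 hsub2)
      rw [Finset.card_union_of_disjoint hdisj, hc1, hc2] at hcard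
      refine le_trans ?_ hcard
      refine le_trans ?_ (add_le_add ih1 ih2)
      rw [e]
      by_cases ht2 : changes (b :: l) + 2 < t + 1
      · rw [show changes (b :: l) + 1 + 2 - (t + 1) = 0 by omega]
        simp
      · rw [show changes (b :: l) + 1 + 2 - (t + 1) = (changes (b :: l) + 2 - (t + 1)) + 1 by omega,
          Nat.choose_succ_succ, add_comm]
        exact Nat.add_le_add_left (Nat.choose_le_choose _ (by omega)) _

/-- After any symbol, one choice of the next creates no change and `q - 1` choices create one. This
exact generating function supplies the exponential moment for the tail bound. -/
theorem sum_pow_changes_cons {q : ℕ} (n : ℕ) (a : Fin q) (z : ℝ) :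
    ∑ l ∈ words q n, z ^ changes (a :: l) = (1 + (q - 1) * z) ^ n := by
  induction n generalizing a with
  | zero => simp [words, changes]
  | succ n ih =>
    rw [sum_words_succ]
    have e : ∀ b : Fin q, ∑ l ∈ words q n, z ^ changes (a :: b :: l)
        = (if a = b then 1 else z) * (1 + (q - 1) * z) ^ n := by
      intro b
      rw [← ih b, Finset.mul_sum]
      exact Finset.sum_congr rfl fun l _ => by
        simp only [changes]
        split_ifs <;> ring
    rw [Finset.sum_congr rfl fun b _ => e b, ← Finset.sum_mul, pow_succ']
    congr 1
    rw [← Finset.add_sum_erase _ _ (Finset.mem_univ a), if_pos rfl,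
      Finset.sum_congr rfl (g := fun _ => z)
        fun b hb => if_neg (Finset.ne_of_mem_erase hb).symm]
    have hq : 1 ≤ q := by have := a.2; omega
    simp [Finset.card_erase_of_mem, Nat.cast_sub hq]

theorem sum_pow_changes {q : ℕ} (n : ℕ) (z : ℝ) :
    ∑ l ∈ words q (n + 1), z ^ changes l = q * (1 + (q - 1) * z) ^ n := by
  simp [sum_words_succ, sum_pow_changes_cons]

/-! ### Asymptotics of ball sizes -/

theorem tendsto_natCast_choose_div_pow {a : ℕ → ℕ} {c : ℝ} (hc : 0 < c)
    (ha : Tendsto (fun n : ℕ => (a n : ℝ) / n) atTop (𝓝 c)) (k : ℕ) :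
    Tendsto (fun n : ℕ => ((a n).choose k : ℝ) / (n : ℝ) ^ k) atTop
      (𝓝 (c ^ k / k.factorial)) := by
  have hinf : Tendsto a atTop atTop := by
    rw [← tendsto_natCast_atTop_iff (R := ℝ)]
    refine (ha.pos_mul_atTop hc tendsto_natCast_atTop_atTop).congr' ?_
    filter_upwards [eventually_gt_atTop 0] with n hn
    have : (n : ℝ) ≠ 0 := by positivity
    field_simp
  have h := (isEquivalent_choose k).comp_tendsto hinf
  have h1 := (Asymptotics.isEquivalent_iff_tendsto_one (by
    filter_upwards [hinf.eventually_gt_atTop 0] with n hn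
    have : (0 : ℝ) < a n := by exact_mod_cast hn
    simp only [Function.comp]
    positivity)).1 h
  have h2 := h1.mul ((ha.pow k).div_const (k.factorial : ℝ))
  rw [one_mul] at h2
  refine h2.congr' ?_
  filter_upwards [hinf.eventually_gt_atTop 0, eventually_gt_atTop 0] with n hn hn'
  have e1 : (a n : ℝ) ≠ 0 := by positivity
  have e2 : (n : ℝ) ≠ 0 := by positivity
  have e3 : (k.factorial : ℝ) ≠ 0 := by positivity
  simp only [Function.comp, Pi.div_apply, div_pow]
  field_simp

theorem tendsto_insertionBallSize_div_pow {q : ℕ} (hq : 1 ≤ q) (R : ℕ) :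
    Tendsto (fun n : ℕ => (insertionBallSize q n R : ℝ) / (n : ℝ) ^ R) atTop
      (𝓝 ((q - 1 : ℝ) ^ R / R.factorial)) := by
  have ha : Tendsto (fun n : ℕ => ((n + R : ℕ) : ℝ) / n) atTop (𝓝 1) := by
    have h := (tendsto_const_div_atTop_nhds_zero_nat (R : ℝ)).const_add 1
    rw [add_zero] at h
    refine h.congr' ?_
    filter_upwards [eventually_gt_atTop 0] with n hn
    have : (n : ℝ) ≠ 0 := by positivity
    push_cast
    field_simp
  have h : ∀ i ∈ Finset.range (R + 1), Tendsto
      (fun n : ℕ => ((n + R).choose i * (q - 1) ^ i : ℕ) / (n : ℝ) ^ R) atTop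
      (𝓝 (if i = R then (q - 1 : ℝ) ^ R / R.factorial else 0)) := by
    intro i hi
    have hc := (tendsto_natCast_choose_div_pow one_pos ha i).mul_const ((q - 1 : ℝ) ^ i)
    split_ifs with hiR
    · subst hiR
      rw [one_pow, one_div_mul_eq_div] at hc
      refine hc.congr fun n => ?_
      push_cast [Nat.cast_sub hq]
      ring
    · have hlt : 0 < R - i := by have := Finset.mem_range.1 hi; omega
      have h0 : Tendsto (fun n : ℕ => ((n : ℝ) ^ (R - i))⁻¹) atTop (𝓝 0) :=
        ((tendsto_pow_atTop hlt.ne').comp tendsto_natCast_atTop_atTop).inv_tendsto_atTop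
      have h1 := hc.mul h0
      rw [mul_zero] at h1
      refine h1.congr fun n => ?_
      have : R = i + (R - i) := by omega
      conv_rhs => rw [this, pow_add]
      rw [← this]
      push_cast [Nat.cast_sub hq]
      rw [div_mul_eq_mul_div, div_eq_mul_inv, div_eq_mul_inv, mul_inv]
      ring
  have hs := tendsto_finsetSum _ h
  rw [Finset.sum_ite_eq' _ R, if_pos (Finset.self_mem_range_succ R)] at hs
  refine hs.congr fun n => ?_
  rw [insertionBallSize, Nat.cast_sum, Finset.sum_div]

theorem insertionBallSize_pos (q n R : ℕ) : 0 < insertionBallSize q n R :=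
  Finset.sum_pos' (fun _ _ => Nat.zero_le _) ⟨0, by simp, by simp⟩

/-- This is the price of comparing densities at proportional lengths. -/
theorem tendsto_insertionBallSize_div {q : ℕ} (hq : 2 ≤ q) (R : ℕ) {f : ℕ → ℕ} {c : ℝ}
    (hc : 0 < c) (hf : Tendsto (fun n : ℕ => (f n : ℝ) / n) atTop (𝓝 c)) :
    Tendsto (fun n : ℕ => (insertionBallSize q n R : ℝ) / insertionBallSize q (f n) R) atTop
      (𝓝 (c⁻¹ ^ R)) := by
  have hinf : Tendsto f atTop atTop := by
    rw [← tendsto_natCast_atTop_iff (R := ℝ)]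
    refine (hf.pos_mul_atTop hc tendsto_natCast_atTop_atTop).congr' ?_
    filter_upwards [eventually_gt_atTop 0] with n hn
    have : (n : ℝ) ≠ 0 := by positivity
    field_simp
  have h := tendsto_insertionBallSize_div_pow (by omega : 1 ≤ q) R
  have hq' : (0 : ℝ) < q - 1 := by
    have : (2 : ℝ) ≤ q := by exact_mod_cast hq
    linarith
  have hv : (q - 1 : ℝ) ^ R / R.factorial ≠ 0 := by positivity
  have h1 := (h.div (h.comp hinf) hv).mul ((hf.inv₀ hc.ne').pow R)
  rw [div_self hv, one_mul] at h1
  refine h1.congr' ?_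
  filter_upwards [hinf.eventually_gt_atTop 0, eventually_gt_atTop 0] with n hn hn'
  have e1 : (f n : ℝ) ≠ 0 := by positivity
  have e2 : (n : ℝ) ≠ 0 := by positivity
  have e3 : (insertionBallSize q (f n) R : ℝ) ≠ 0 := by
    exact_mod_cast (insertionBallSize_pos q (f n) R).ne'
  simp only [Function.comp, Pi.div_apply, inv_pow, div_pow]
  field_simp

/-! ### Concentration, and the uncovered fraction -/

/-- Words with at least `k` changes have many subsequences and give the first exponential; the
others are bounded by Chernoff's method with parameter `s`. -/
theorem sum_pow_card_deletionSphere_le {q R : ℕ} (hq : 1 ≤ q) (hR : 1 ≤ R) (n k : ℕ) {p s : ℝ}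
    (h0 : 0 ≤ p) (h1 : p ≤ 1) (hs : 0 ≤ s) :
    ∑ y ∈ words q (n + R), (1 - p) ^ (deletionSphere R y).card ≤ (q : ℝ) ^ (n + R) *
      (Real.exp (-(p * (k + 2 - R).choose R)) +
        Real.exp (s * k - (1 - 1 / q) * (s / (1 + s)) * n)) := by
  have hq0 : (0 : ℝ) < q := by exact_mod_cast hq
  have hq1 : (1 : ℝ) ≤ q := by exact_mod_cast hq
  have hpt : ∀ y ∈ words q (n + R), (1 - p) ^ (deletionSphere R y).card ≤
      Real.exp (-(p * (k + 2 - R).choose R)) + Real.exp (s * k) * Real.exp (-s) ^ changes y := by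
    intro y hy
    have hle := choose_le_card_deletionSphere y R (by rw [mem_words.1 hy]; omega)
    by_cases hk : k ≤ changes y
    · have hle2 : (k + 2 - R).choose R ≤ (deletionSphere R y).card :=
        le_trans (Nat.choose_le_choose _ (by omega)) hle
      have h2 : (1 - p) ^ (deletionSphere R y).card ≤ Real.exp (-(p * (k + 2 - R).choose R)) := by
        calc (1 - p) ^ (deletionSphere R y).card ≤ (1 - p) ^ (k + 2 - R).choose R :=
              pow_le_pow_of_le_one (by linarith) (by linarith) hle2
          _ ≤ Real.exp (-p) ^ (k + 2 - R).choose R :=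
              pow_le_pow_left₀ (by linarith) (by linarith [Real.add_one_le_exp (-p)]) _
          _ = _ := by rw [← Real.exp_nat_mul]; ring_nf
      have : 0 ≤ Real.exp (s * k) * Real.exp (-s) ^ changes y := by positivity
      linarith
    · have h2 : (1 - p) ^ (deletionSphere R y).card ≤ 1 :=
        pow_le_one₀ (by linarith) (by linarith)
      have h3 : 1 ≤ Real.exp (s * k) * Real.exp (-s) ^ changes y := by
        rw [← Real.exp_nat_mul, ← Real.exp_add]
        refine Real.one_le_exp ?_
        have : (changes y : ℝ) ≤ k := by exact_mod_cast (by omega : changes y ≤ k)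
        nlinarith
      have : 0 ≤ Real.exp (-(p * (k + 2 - R).choose R)) := by positivity
      linarith
  refine le_trans (Finset.sum_le_sum hpt) ?_
  rw [Finset.sum_add_distrib, Finset.sum_const, card_words, nsmul_eq_mul, ← Finset.mul_sum,
    mul_add, Nat.cast_pow]
  refine add_le_add le_rfl ?_
  obtain ⟨N, hN⟩ : ∃ N, n + R = N + 1 := ⟨n + R - 1, by omega⟩
  have hnN : (n : ℝ) ≤ N := by exact_mod_cast (by omega : n ≤ N)
  rw [hN, sum_pow_changes, sub_eq_add_neg (s * k), Real.exp_add]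
  -- A rational bound on `exp (-s)` keeps the Chernoff exponent explicit.
  have hes : Real.exp (-s) ≤ 1 / (1 + s) := by
    rw [Real.exp_neg, ← one_div]
    exact one_div_le_one_div_of_le (by linarith) (by linarith [Real.add_one_le_exp s])
  have hb : 1 + (q - 1 : ℝ) * Real.exp (-s) ≤
      q * Real.exp (-((1 - 1 / q) * (s / (1 + s)))) := by
    have h2 := Real.add_one_le_exp (-((1 - 1 / q : ℝ) * (s / (1 + s))))
    have h3 : (q : ℝ) * (-((1 - 1 / q : ℝ) * (s / (1 + s))) + 1) = 1 + (q - 1) * (1 / (1 + s)) := by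
      have : 1 + s ≠ 0 := by positivity
      field_simp
      ring
    calc 1 + (q - 1 : ℝ) * Real.exp (-s) ≤ 1 + (q - 1) * (1 / (1 + s)) := by
          have := mul_le_mul_of_nonneg_left hes (sub_nonneg.2 hq1)
          linarith
      _ = _ := h3.symm
      _ ≤ _ := mul_le_mul_of_nonneg_left h2 hq0.le
  have hpw : (1 + (q - 1 : ℝ) * Real.exp (-s)) ^ N ≤
      (q : ℝ) ^ N * Real.exp (-((1 - 1 / q) * (s / (1 + s)) * n)) := by
    refine le_trans (pow_le_pow_left₀ (by nlinarith [Real.exp_pos (-s)]) hb N) ?_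
    rw [mul_pow, ← Real.exp_nat_mul]
    refine mul_le_mul_of_nonneg_left (Real.exp_le_exp.2 ?_) (by positivity)
    have h4 : (0 : ℝ) ≤ (1 - 1 / q) * (s / (1 + s)) := by
      refine mul_nonneg (sub_nonneg.2 ?_) (by positivity)
      rw [div_le_one hq0]
      exact hq1
    nlinarith
  have := mul_le_mul_of_nonneg_left hpw (mul_nonneg (Real.exp_pos (s * k)).le hq0.le)
  calc _ = Real.exp (s * k) * q * (1 + (q - 1 : ℝ) * Real.exp (-s)) ^ N := by ring
    _ ≤ _ := this
    _ = _ := by ring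

/-- Almost all words have almost the average number of subsequences, so that a random code of
density `μ` leaves a fraction of about `exp (-μ)` uncovered. -/
theorem eventually_sum_pow_card_deletionSphere_le {q R : ℕ} (hq : 2 ≤ q) (hR : 1 ≤ R) {μ ν : ℝ}
    (hν : 0 < ν) (hμ : ν < μ) :
    ∀ᶠ n : ℕ in atTop, μ * q ^ R / insertionBallSize q n R ≤ 1 ∧
      ∑ y ∈ words q (n + R),
        (1 - μ * (q : ℝ) ^ R / insertionBallSize q n R) ^ (deletionSphere R y).card
        ≤ Real.exp (-ν) * (q : ℝ) ^ (n + R) := by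
  have hq2 : (2 : ℝ) ≤ q := by exact_mod_cast hq
  have hμ0 : 0 < μ := hν.trans hμ
  have hV := tendsto_insertionBallSize_div_pow (by omega : 1 ≤ q) R
  have hq' : (0 : ℝ) < q - 1 := by linarith
  have hv : 0 < (q - 1 : ℝ) ^ R / R.factorial := by positivity
  have hV0 : ∀ n, (0 : ℝ) < insertionBallSize q n R := fun n => by
    exact_mod_cast insertionBallSize_pos q n R
  have hVinf : Tendsto (fun n : ℕ => (insertionBallSize q n R : ℝ)) atTop atTop := by
    refine (hV.pos_mul_atTop hv
      ((tendsto_pow_atTop (by omega : R ≠ 0)).comp tendsto_natCast_atTop_atTop)).congr' ?_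
    filter_upwards [eventually_gt_atTop 0] with n hn
    have : (n : ℝ) ≠ 0 := by positivity
    simp only [Function.comp]
    field_simp
  -- The threshold for changes will be `θ` times the mean `γ n`; `θ` is so close to 1 that the loss
  -- `θ ^ R` still leaves more than `ν`.
  obtain ⟨θ, hθ1, hθ0, hθ⟩ : ∃ θ : ℝ, θ < 1 ∧ 0 < θ ∧ ν < μ * θ ^ R := by
    have hcont : ContinuousAt (fun θ : ℝ => μ * θ ^ R) 1 := by fun_prop
    have h1 : ∀ᶠ θ in 𝓝[<] (1 : ℝ), ν < μ * θ ^ R :=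
      (hcont.eventually_const_lt (by simpa using hμ)).filter_mono nhdsWithin_le_nhds
    have h2 : ∀ᶠ θ in 𝓝[<] (1 : ℝ), 0 < θ :=
      (eventually_gt_nhds one_pos).filter_mono nhdsWithin_le_nhds
    obtain ⟨θ, h⟩ := (h1.and (h2.and self_mem_nhdsWithin)).exists
    exact ⟨θ, h.2.2, h.2.1, h.1⟩
  set γ : ℝ := 1 - 1 / q with hγ
  have hγ0 : 0 < γ := by
    rw [hγ, sub_pos, div_lt_one (by linarith)]
    linarith
  -- Chernoff's exponent is negative exactly when `θ (1 + s) < 1`; this is half the largest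
  -- admissible value.
  set s : ℝ := (1 / θ - 1) / 2 with hs
  have hθ' : 1 < 1 / θ := by rwa [lt_div_iff₀ hθ0, one_mul]
  have hs0 : 0 < s := by rw [hs]; linarith
  have hgap : 0 < γ * (s / (1 + s)) - s * (γ * θ) := by
    have h1 : θ * (1 + s) < 1 := by
      have : θ * (1 / θ) = 1 := by field_simp
      have e : θ * (1 + s) = (θ + θ * (1 / θ)) / 2 := by rw [hs]; ring
      rw [e, this]
      linarith
    have h2 : γ * (s / (1 + s)) - s * (γ * θ) = γ * s * (1 - θ * (1 + s)) / (1 + s) := by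
      field_simp
    rw [h2]
    have : 0 < 1 - θ * (1 + s) := by linarith
    positivity
  have hκ0 : 0 < γ * θ := by positivity
  have hfl : Tendsto (fun n : ℕ => (⌊γ * θ * n⌋₊ : ℝ) / n) atTop (𝓝 (γ * θ)) :=
    (tendsto_nat_floor_mul_div_atTop hκ0.le).comp tendsto_natCast_atTop_atTop
  have hflinf : Tendsto (fun n : ℕ => ⌊γ * θ * n⌋₊) atTop atTop :=
    tendsto_nat_floor_atTop.comp (tendsto_natCast_atTop_atTop.const_mul_atTop hκ0)
  have ha : Tendsto (fun n : ℕ => ((⌊γ * θ * n⌋₊ + 2 - R : ℕ) : ℝ) / n) atTop (𝓝 (γ * θ)) := by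
    have h1 := hfl.add (tendsto_const_div_atTop_nhds_zero_nat (2 - R : ℝ))
    rw [add_zero] at h1
    refine h1.congr' ?_
    filter_upwards [hflinf.eventually_ge_atTop R] with n hn
    rw [Nat.cast_sub (by omega)]
    push_cast
    ring
  have hch := tendsto_natCast_choose_div_pow hκ0 ha R
  have hpc : Tendsto (fun n : ℕ => μ * (q : ℝ) ^ R / insertionBallSize q n R *
      (⌊γ * θ * n⌋₊ + 2 - R).choose R) atTop (𝓝 (μ * θ ^ R)) := by
    have h1 := (hch.div hV hv.ne').const_mul (μ * (q : ℝ) ^ R)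
    have e : μ * (q : ℝ) ^ R * ((γ * θ) ^ R / R.factorial / ((q - 1 : ℝ) ^ R / R.factorial))
        = μ * θ ^ R := by
      have : γ * q = q - 1 := by
        rw [hγ]
        field_simp
      have h2 : (R.factorial : ℝ) ≠ 0 := by positivity
      rw [div_div_div_cancel_right₀ h2, ← this, mul_pow, mul_pow]
      field_simp
    rw [e] at h1
    refine h1.congr' ?_
    filter_upwards [eventually_gt_atTop 0] with n hn
    have h2 : (n : ℝ) ≠ 0 := by positivity
    have h3 := (hV0 n).ne'
    simp only [Pi.div_apply]
    field_simp
  have hlim : Tendsto (fun n : ℕ => Real.exp (-(μ * (q : ℝ) ^ R / insertionBallSize q n R *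
      (⌊γ * θ * n⌋₊ + 2 - R).choose R)) +
      Real.exp (-((γ * (s / (1 + s)) - s * (γ * θ)) * n))) atTop
      (𝓝 (Real.exp (-(μ * θ ^ R)) + 0)) :=
    ((Real.continuous_exp.tendsto _).comp hpc.neg).add
      (Real.tendsto_exp_neg_atTop_nhds_zero.comp
        (tendsto_natCast_atTop_atTop.const_mul_atTop hgap))
  rw [add_zero] at hlim
  filter_upwards [hlim.eventually_lt_const (Real.exp_lt_exp.2 (neg_lt_neg hθ)),
    hVinf.eventually_ge_atTop (μ * q ^ R)] with n hn hn2
  have hp1 : μ * (q : ℝ) ^ R / insertionBallSize q n R ≤ 1 := (div_le_one (hV0 n)).2 hn2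
  refine ⟨hp1, ?_⟩
  refine le_trans (sum_pow_card_deletionSphere_le (by omega) hR n ⌊γ * θ * n⌋₊ ?_ hp1 hs0.le) ?_
  · have := hV0 n
    positivity
  · rw [mul_comm]
    refine mul_le_mul_of_nonneg_right (le_trans (add_le_add le_rfl (Real.exp_le_exp.2 ?_)) hn.le)
      (by positivity)
    have h1 := Nat.floor_le (show 0 ≤ γ * θ * (n : ℝ) by positivity)
    have h2 := mul_le_mul_of_nonneg_left h1 hs0.le
    rw [← hγ]
    linarith

/-! ### The recursion for the density -/

/-- The excess of `d` over the fixed point `M = α / (1 - β)` shrinks by the factor `β` at each use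
of the recursion. Strong induction bounds it first, since `f n < n` eventually. -/
theorem eventually_le_of_recursion {d : ℕ → ℝ} {f : ℕ → ℕ} {α β T : ℝ}
    (hf : Tendsto f atTop atTop) (hlt : ∀ᶠ n in atTop, f n < n) (hβ0 : 0 ≤ β) (hβ1 : β < 1)
    (h : ∀ᶠ n in atTop, d n ≤ α + β * d (f n)) (hT : α / (1 - β) < T) :
    ∀ᶠ n in atTop, d n ≤ T := by
  set M := α / (1 - β) with hM
  have hαM : α = M - β * M := by
    rw [hM]
    field_simp [(sub_pos.2 hβ1).ne']
  obtain ⟨N, hN⟩ := eventually_atTop.1 (hlt.and h)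
  obtain ⟨B, hB⟩ : ∃ B : ℝ, ∀ n, d n ≤ M + B := by
    obtain ⟨B, hB⟩ := ((Finset.range N).image fun n => d n - M).bddAbove
    refine ⟨max B 0, fun n => ?_⟩
    induction n using Nat.strong_induction_on with
    | _ n ih =>
      by_cases hn : n < N
      · have h1 : d n - M ≤ B :=
          hB (Finset.mem_coe.2 (Finset.mem_image_of_mem _ (Finset.mem_range.2 hn)))
        have h2 := le_max_left B 0
        linarith
      · obtain ⟨h1, h2⟩ := hN n (not_lt.1 hn)
        have h3 := mul_le_mul_of_nonneg_left (ih _ h1) hβ0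
        have h4 := mul_nonneg (sub_nonneg.2 hβ1.le) (le_max_right B 0)
        linarith
  have hk : ∀ k : ℕ, ∀ᶠ n in atTop, d n ≤ M + β ^ k * B := by
    intro k
    induction k with
    | zero => exact Eventually.of_forall fun n => by simpa using hB n
    | succ k ih =>
      filter_upwards [hf.eventually ih, h] with n h1 h2
      have h3 := mul_le_mul_of_nonneg_left h1 hβ0
      rw [pow_succ]
      linarith
  have hlim : Tendsto (fun k : ℕ => M + β ^ k * B) atTop (𝓝 (M + 0 * B)) :=
    ((tendsto_pow_atTop_nhds_zero_of_lt_one hβ0 hβ1).mul_const B).const_add M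
  rw [zero_mul, add_zero] at hlim
  obtain ⟨k, hkT⟩ := (hlim.eventually_lt_const hT).exists
  exact (hk k).mono fun n hn => hn.trans hkT.le

theorem insertionDensity_nonneg (q n R : ℕ) : 0 ≤ insertionDensity q n R := by
  unfold insertionDensity
  positivity

theorem eventually_insertionDensity_le_add {q R : ℕ} (hq : 2 ≤ q) (hR : 1 ≤ R) {μ ν : ℝ}
    (hν : 0 < ν) (hμ : ν < μ) : ∀ᶠ n : ℕ in atTop, insertionDensity q n R ≤
      μ * (insertionBallSize q n R / insertionBallSize q (n - R - n / (R + 1)) R) +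
      Real.exp (-ν) * (insertionBallSize q n R / insertionBallSize q (n / (R + 1)) R) *
        insertionDensity q (n / (R + 1)) R := by
  obtain ⟨N, hN⟩ := eventually_atTop.1 (eventually_sum_pow_card_deletionSphere_le hq hR hν hμ)
  -- As `k ≤ n / 2`, this leaves `m ≥ N` for the randomly covered block.
  filter_upwards [eventually_ge_atTop (2 * (N + R))] with n hn
  obtain ⟨k, hk⟩ : ∃ k, n / (R + 1) = k := ⟨_, rfl⟩
  have hk2 : k ≤ n / 2 := hk ▸ Nat.div_le_div_left (by omega) (by omega)
  obtain ⟨m, hm⟩ : ∃ m, n - R - k = m := ⟨_, rfl⟩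
  rw [hk, hm]
  obtain ⟨h1, h2⟩ := hN m (by omega)
  have hV : ∀ n, (0 : ℝ) < insertionBallSize q n R := fun n => by
    exact_mod_cast insertionBallSize_pos q n R
  have hq0 : (0 : ℝ) < q := by positivity
  have hμ0 := hν.trans hμ
  have h3 := minInsertionCovering_add_le_sum (q := q) (R := R) m k
    (p := μ * (q : ℝ) ^ R / insertionBallSize q m R)
    (by have := hV m; positivity) h1
  have hnm : n = m + R + k := by omega
  have h4 := h3.trans (add_le_add le_rfl (mul_le_mul_of_nonneg_left h2 (Nat.cast_nonneg _)))
  rw [← hnm] at h4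
  have h5 : (0 : ℝ) ≤ insertionBallSize q n R / (q : ℝ) ^ (n + R) := by positivity
  have h6 := mul_le_mul_of_nonneg_right h4 h5
  unfold insertionDensity
  refine le_trans (le_of_eq (by ring)) (h6.trans (le_of_eq ?_))
  have e1 := (hV m).ne'
  have e2 := (hV k).ne'
  rw [hnm]
  simp only [pow_add]
  field_simp

theorem eventually_insertionDensity_le {q R : ℕ} (hq : 2 ≤ q) (hR : 1 ≤ R) {μ T : ℝ}
    (hμ0 : 0 < μ) (hμ : Real.exp (-μ) * (R + 1 : ℝ) ^ R < 1)
    (hT : μ * ((R + 1 : ℝ) / R) ^ R / (1 - Real.exp (-μ) * (R + 1 : ℝ) ^ R) < T) :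
    ∀ᶠ n : ℕ in atTop, insertionDensity q n R ≤ T := by
  have hR0 : (0 : ℝ) < R := by exact_mod_cast hR
  -- One `ε` absorbs the loss from `μ` to `ν = μ - ε` and the errors in both ratios of ball sizes.
  obtain ⟨ε, hε0, hεμ, hε1, hεT⟩ : ∃ ε : ℝ, 0 < ε ∧ ε < μ ∧
      Real.exp (-(μ - ε)) * (R + 1 : ℝ) ^ R + ε < 1 ∧
      (μ * ((R + 1 : ℝ) / R) ^ R + ε) /
        (1 - (Real.exp (-(μ - ε)) * (R + 1 : ℝ) ^ R + ε)) < T := by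
    have c1 : ContinuousAt (fun ε : ℝ => Real.exp (-(μ - ε)) * (R + 1 : ℝ) ^ R + ε) 0 := by
      fun_prop
    have c2 : ContinuousAt (fun ε : ℝ => (μ * ((R + 1 : ℝ) / R) ^ R + ε) /
        (1 - (Real.exp (-(μ - ε)) * (R + 1 : ℝ) ^ R + ε))) 0 := by
      refine ContinuousAt.div (by fun_prop) (by fun_prop) ?_
      simp only [sub_zero, add_zero]
      linarith
    have l1 := (c1.eventually_lt_const (by simpa using hμ)).filter_mono
      (nhdsWithin_le_nhds (s := Set.Ioi 0))
    have l2 := (c2.eventually_lt_const (by simpa using hT)).filter_mono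
      (nhdsWithin_le_nhds (s := Set.Ioi 0))
    have l3 := (eventually_lt_nhds hμ0).filter_mono (nhdsWithin_le_nhds (s := Set.Ioi 0))
    have l4 : ∀ᶠ ε : ℝ in 𝓝[>] 0, 0 < ε := self_mem_nhdsWithin
    obtain ⟨ε, h⟩ := (l4.and (l3.and (l1.and l2))).exists
    exact ⟨ε, h⟩
  have hf : Tendsto (fun n : ℕ => ((n / (R + 1) : ℕ) : ℝ) / n) atTop (𝓝 (1 / (R + 1))) := by
    refine ((tendsto_nat_floor_mul_div_atTop (show (0 : ℝ) ≤ 1 / (R + 1) by positivity)).comp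
      tendsto_natCast_atTop_atTop).congr fun n => ?_
    simp only [Function.comp]
    rw [one_div_mul_eq_div, ← Nat.floor_div_eq_div (K := ℝ)]
    push_cast
    rfl
  have hg : Tendsto (fun n : ℕ => ((n - R - n / (R + 1) : ℕ) : ℝ) / n) atTop
      (𝓝 (R / (R + 1))) := by
    have h1 := ((tendsto_const_div_atTop_nhds_zero_nat (R : ℝ)).const_sub 1).sub hf
    rw [show (1 - 0 - 1 / (R + 1) : ℝ) = R / (R + 1) by field_simp; ring] at h1
    refine h1.congr' ?_
    filter_upwards [eventually_ge_atTop (2 * (R + 1))] with n hn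
    have h2 : n / (R + 1) ≤ n / 2 := Nat.div_le_div_left (by omega) (by omega)
    have h3 : (n : ℝ) ≠ 0 := by
      have : n ≠ 0 := by omega
      exact_mod_cast this
    rw [Nat.cast_sub (by omega), Nat.cast_sub (by omega)]
    field_simp
  have hr1 := (tendsto_insertionBallSize_div hq R (by positivity) hg).const_mul μ
  have hr2 := (tendsto_insertionBallSize_div hq R (by positivity) hf).const_mul
    (Real.exp (-(μ - ε)))
  rw [inv_div] at hr1
  rw [one_div, inv_inv] at hr2
  have hfinf : Tendsto (fun n : ℕ => n / (R + 1)) atTop atTop :=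
    Nat.tendsto_div_const_atTop (by omega)
  refine eventually_le_of_recursion hfinf ?_ ?_ hε1 ?_ hεT
  · filter_upwards [eventually_gt_atTop 0] with n hn
    exact Nat.div_lt_self hn (by omega)
  · positivity
  · filter_upwards [eventually_insertionDensity_le_add hq hR (sub_pos.2 hεμ)
      (show μ - ε < μ by linarith), hr1.eventually_lt_const (lt_add_of_pos_right _ hε0),
      hr2.eventually_lt_const (lt_add_of_pos_right _ hε0)] with n h1 h2 h3
    exact h1.trans (add_le_add h2.le
      (mul_le_mul_of_nonneg_right h3.le (insertionDensity_nonneg q _ R)))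

/-! ### Choice of the density parameter -/

/-- With `a = R log R`, this fits the excess over `a + 1` into the square root term. The logarithm
is bounded by its tangent in `s / 4`, where `s = √(2a) ≥ 4`. -/
theorem one_add_log_mul_le_sqrt {a : ℝ} (ha : 8 ≤ a) :
    1 + Real.log (a + 2) * (1 + 1 / (a + 1)) ≤ Real.sqrt (2 * a) := by
  obtain ⟨s, hs⟩ : ∃ s, Real.sqrt (2 * a) = s := ⟨_, rfl⟩
  have hsq : s ^ 2 = 2 * a := by rw [← hs, Real.sq_sqrt (by linarith)]
  have hs4 : 4 ≤ s := by
    rw [← hs]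
    exact Real.le_sqrt_of_sq_le (by linarith)
  rw [hs]
  have h10 : Real.log 10 ≤ 5 / 2 := by
    rw [Real.log_le_iff_le_exp (by norm_num)]
    have h1 : Real.exp (5 / 2) ^ 2 = Real.exp 1 ^ 5 := by
      rw [← Real.exp_nat_mul, ← Real.exp_nat_mul]; norm_num
    have h2 : (2.7 : ℝ) ^ 5 ≤ Real.exp 1 ^ 5 :=
      pow_le_pow_left₀ (by norm_num) (by linarith [Real.exp_one_gt_d9]) 5
    refine le_of_pow_le_pow_left₀ two_ne_zero (by positivity) ?_
    rw [h1]
    norm_num at h2 ⊢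
    linarith
  have hlog : Real.log (a + 2) ≤ 1 / 2 + s / 2 := by
    have h1 : a + 2 ≤ 10 * (s / 4) ^ 2 := by nlinarith
    have h2 : Real.log (a + 2) ≤ Real.log 10 + 2 * Real.log (s / 4) := by
      refine (Real.log_le_log (by linarith) h1).trans (le_of_eq ?_)
      rw [Real.log_mul (by norm_num) (by positivity), Real.log_pow]
      norm_num
    have h3 := Real.log_le_sub_one_of_pos (show 0 < s / 4 by linarith)
    linarith
  have hfrac : 1 / (a + 1) ≤ 1 / 9 := one_div_le_one_div_of_le (by norm_num) (by linarith)
  have h0 : 0 ≤ Real.log (a + 2) := Real.log_nonneg (by linarith)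
  nlinarith [mul_le_mul_of_nonneg_left hfrac h0]

theorem exp_neg_le_of_le_pow {k : ℕ} {b : ℝ} (hb : 0 < b) (h : b ≤ 2.718 ^ k) :
    Real.exp (-k) ≤ b⁻¹ := by
  rw [Real.exp_neg]
  refine inv_anti₀ hb (h.trans ?_)
  rw [← Real.exp_one_pow]
  exact pow_le_pow_left₀ (by norm_num) (by linarith [Real.exp_one_gt_d9]) k

theorem exists_density_parameter {R : ℕ} (hR : 2 ≤ R) :
    ∃ μ : ℝ, 0 < μ ∧ Real.exp (-μ) * (R + 1 : ℝ) ^ R < 1 ∧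
      μ * ((R + 1 : ℝ) / R) ^ R / (1 - Real.exp (-μ) * (R + 1 : ℝ) ^ R) ≤
        Real.exp 1 * ((R : ℝ) * Real.log R + Real.sqrt (2 * (R : ℝ) * Real.log R) + 1) := by
  have he := Real.exp_one_gt_d9
  have hlog2 := Real.log_two_gt_d9
  -- The general estimate needs `R log R ≥ 8`, true from `R = 5` on; for 2, 3, 4 the values `μ = 4,
  -- 6, 9` are checked numerically.
  obtain rfl | rfl | rfl | hR5 : R = 2 ∨ R = 3 ∨ R = 4 ∨ 5 ≤ R := by omega
  · have h := exp_neg_le_of_le_pow (k := 4) (b := 54) (by norm_num) (by norm_num)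
    have hs : (1.665 : ℝ) ≤ Real.sqrt (2 * (2 : ℕ) * Real.log (2 : ℕ)) :=
      Real.le_sqrt_of_sq_le (by push_cast; linarith)
    push_cast at h hs ⊢
    refine ⟨4, by norm_num, by norm_num; linarith, ?_⟩
    rw [div_le_iff₀ (by norm_num; linarith)]
    norm_num at h ⊢
    have h1 : (10.9 : ℝ) ≤
        Real.exp 1 * (2 * Real.log 2 + Real.sqrt (2 * 2 * Real.log 2) + 1) := by
      norm_num at hs ⊢
      nlinarith
    norm_num at h1
    nlinarith
  · have h := exp_neg_le_of_le_pow (k := 6) (b := 400) (by norm_num) (by norm_num)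
    have hlog3 : (1 : ℝ) ≤ Real.log 3 := by
      rw [Real.le_log_iff_exp_le (by norm_num)]
      linarith [Real.exp_one_lt_d9]
    have hs : (2.4 : ℝ) ≤ Real.sqrt (2 * (3 : ℕ) * Real.log (3 : ℕ)) :=
      Real.le_sqrt_of_sq_le (by push_cast; linarith)
    push_cast at h hs ⊢
    refine ⟨6, by norm_num, by norm_num; linarith, ?_⟩
    rw [div_le_iff₀ (by norm_num; linarith)]
    norm_num at h ⊢
    have h1 : (17 : ℝ) ≤
        Real.exp 1 * (3 * Real.log 3 + Real.sqrt (2 * 3 * Real.log 3) + 1) := by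
      norm_num at hs ⊢
      nlinarith
    norm_num at h1
    nlinarith
  · have h := exp_neg_le_of_le_pow (k := 9) (b := 8000) (by norm_num) (by norm_num)
    have hlog4 : (1.38 : ℝ) ≤ Real.log 4 := by
      rw [show (4 : ℝ) = 2 ^ 2 by norm_num, Real.log_pow]
      push_cast
      linarith
    have hs : (3 : ℝ) ≤ Real.sqrt (2 * (4 : ℕ) * Real.log (4 : ℕ)) :=
      Real.le_sqrt_of_sq_le (by push_cast; linarith)
    push_cast at h hs ⊢
    refine ⟨9, by norm_num, by norm_num; linarith, ?_⟩
    rw [div_le_iff₀ (by norm_num; linarith)]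
    norm_num at h ⊢
    have h1 : (25 : ℝ) ≤
        Real.exp 1 * (4 * Real.log 4 + Real.sqrt (2 * 4 * Real.log 4) + 1) := by
      norm_num at hs ⊢
      nlinarith
    norm_num at h1
    nlinarith
  have hR5' : (5 : ℝ) ≤ R := by exact_mod_cast hR5
  have hR0 : (0 : ℝ) < R := by linarith
  set a : ℝ := R * Real.log R with ha
  have ha8 : 8 ≤ a := by
    have h5 : (8 / 5 : ℝ) ≤ Real.log R := by
      rw [Real.le_log_iff_exp_le hR0]
      refine le_trans ?_ hR5'
      have h1 : Real.exp (8 / 5) ^ 5 = Real.exp 1 ^ 8 := by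
        rw [← Real.exp_nat_mul, ← Real.exp_nat_mul]; norm_num
      have h2 : Real.exp 1 ^ 8 ≤ (2.72 : ℝ) ^ 8 :=
        pow_le_pow_left₀ (by positivity) (by linarith [Real.exp_one_lt_d9]) 8
      refine le_of_pow_le_pow_left₀ (n := 5) (by norm_num) (by norm_num) ?_
      rw [h1]
      refine h2.trans (by norm_num)
    nlinarith
  have hup : R * Real.log (R + 1) ≤ a + 1 := by
    have h1 : Real.log (R + 1) = Real.log R + Real.log (1 + 1 / R) := by
      rw [← Real.log_mul hR0.ne' (by positivity)]
      congr 1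
      field_simp
    have h2 := Real.log_le_sub_one_of_pos (show (0 : ℝ) < 1 + 1 / R by positivity)
    have h3 := mul_le_mul_of_nonneg_left h2 hR0.le
    have h4 : (R : ℝ) * (1 + 1 / R - 1) = 1 := by field_simp; ring
    rw [h1, mul_add]
    linarith
  have hexp : Real.exp (-(R * Real.log (R + 1) + Real.log (a + 2))) * (R + 1 : ℝ) ^ R
      = 1 / (a + 2) := by
    rw [neg_add, Real.exp_add, Real.exp_neg, Real.exp_neg, Real.exp_log (by linarith),
      Real.exp_nat_mul, Real.exp_log (by linarith)]
    field_simp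
  have hl0 : 0 ≤ Real.log (a + 2) := Real.log_nonneg (by linarith)
  have hl1 : 0 < R * Real.log (R + 1) := mul_pos hR0 (Real.log_pos (by linarith))
  -- The first term cancels `(R + 1) ^ R` and the second makes the contraction factor `1 / (a + 2)`.
  refine ⟨R * Real.log (R + 1) + Real.log (a + 2), by linarith, ?_, ?_⟩
  · rw [hexp, div_lt_one (by linarith)]
    linarith
  · rw [hexp]
    have hpow : ((R + 1 : ℝ) / R) ^ R ≤ Real.exp 1 := by
      have h1 : (R + 1 : ℝ) / R ≤ Real.exp (1 / R) := by
        refine le_trans (le_of_eq ?_) (Real.add_one_le_exp (1 / (R : ℝ)))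
        field_simp
        ring
      refine (pow_le_pow_left₀ (by positivity) h1 R).trans (le_of_eq ?_)
      rw [← Real.exp_nat_mul]
      congr 1
      field_simp
    have hkey := one_add_log_mul_le_sqrt ha8
    have e : 1 - 1 / (a + 2) = (a + 1) / (a + 2) := by
      have : a + 2 ≠ 0 := by linarith
      field_simp
      ring
    rw [e, mul_comm (_ + _) (_ ^ _), mul_div_assoc,
      show 2 * (R : ℝ) * Real.log R = 2 * a by rw [ha]; ring]
    refine mul_le_mul hpow ?_ (by positivity) (by positivity)
    refine (div_le_div_of_nonneg_right (add_le_add_left hup _) (by positivity)).trans ?_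
    refine le_trans (le_of_eq ?_) (show a + (1 + Real.log (a + 2) * (1 + 1 / (a + 1))) + 1 ≤ _ by
      linarith)
    have h1 : a + 1 ≠ 0 := by linarith
    have h2 : a + 2 ≠ 0 := by linarith
    field_simp
    ring

/-! ### The sphere-covering bound and the theorem -/

theorem one_le_insertionDensity {q : ℕ} (hq : 0 < q) (n R : ℕ) : 1 ≤ insertionDensity q n R := by
  classical
  obtain ⟨C, hC, hcard⟩ := exists_code_card_eq_minInsertionCovering q n R
  have hq0 : (0 : ℝ) < (q : ℝ) ^ (n + R) := by positivity
  rw [insertionDensity, le_div_iff₀ hq0, one_mul, ← hcard]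
  have h : (Finset.univ : Finset (QWord q (n + R))) ⊆ C.biUnion fun c => insertionBall c R :=
    fun y _ => Finset.mem_biUnion.2 (hC y)
  have h1 := (Finset.card_le_card h).trans Finset.card_biUnion_le
  rw [Finset.sum_congr rfl fun c _ => card_insertionBall hq c R] at h1
  simp only [Finset.card_univ, Fintype.card_fun, Fintype.card_fin, Finset.sum_const,
    smul_eq_mul] at h1
  exact_mod_cast h1

theorem asymptoticInsertionDensity_le {q R : ℕ} {T : ℝ} (hT : 0 ≤ T)
    (h : ∀ T' > T, ∀ᶠ n : ℕ in atTop, insertionDensity q n R ≤ T') :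
    asymptoticInsertionDensity q R ≤ ENNReal.ofReal T := by
  refine ENNReal.le_of_forall_pos_le_add fun ε hε _ => ?_
  rw [← ENNReal.ofReal_coe_nnreal (p := ε), ← ENNReal.ofReal_add hT ε.coe_nonneg]
  refine limsup_le_of_le (by isBoundedDefault) ?_
  filter_upwards [h (T + ε) (lt_add_of_pos_right _ (by exact_mod_cast hε))] with n hn
  exact ENNReal.ofReal_le_ofReal hn

/-- For radius one, this lets the absolute bound be multiplied by the factor in the theorem. -/
theorem one_le_asymptoticInsertionDensity {q : ℕ} (hq : 0 < q) (R : ℕ) :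
    1 ≤ asymptoticInsertionDensity q R := by
  refine le_trans (le_of_eq (limsup_const (f := atTop (α := ℕ)) (1 : ENNReal)).symm)
    (limsup_le_limsup (Eventually.of_forall fun n => ?_))
  exact ENNReal.one_le_ofReal.2 (one_le_insertionDensity hq n R)

theorem asymptoticInsertionDensity_one_lt_top {q : ℕ} (hq : 2 ≤ q) :
    asymptoticInsertionDensity q 1 < ⊤ := by
  -- For radius one the contraction factor is `2 exp (-μ)`, and `μ = 2` suffices.
  have h : Real.exp (-2) * ((1 : ℕ) + 1 : ℝ) ^ 1 < 1 := by
    have h := exp_neg_le_of_le_pow (k := 2) (b := 4) (by norm_num) (by norm_num)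
    norm_num at h ⊢
    linarith
  have h2 : 0 ≤ 2 * (((1 : ℕ) + 1 : ℝ) / (1 : ℕ)) ^ 1 /
      (1 - Real.exp (-2) * ((1 : ℕ) + 1 : ℝ) ^ 1) :=
    div_nonneg (by norm_num) (sub_nonneg.2 h.le)
  exact (asymptoticInsertionDensity_le h2 fun T hT =>
    eventually_insertionDensity_le hq le_rfl two_pos h hT).trans_lt ENNReal.ofReal_lt_top

theorem mainTheorem2 :
    (∀ q R : ℕ, 2 ≤ q → 2 ≤ R →
      asymptoticInsertionDensity q 1 < ⊤ ∧
      asymptoticInsertionDensity q R ≤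
        ENNReal.ofReal (Real.exp 1 *
          ((R : ℝ) * Real.log R + Real.sqrt (2 * (R : ℝ) * Real.log R) + 1)) *
        asymptoticInsertionDensity q 1) ∧
    (∃ K : ℝ, 0 < K ∧ ∀ q R : ℕ, 2 ≤ q → 2 ≤ R →
      ∀ᶠ n : ℕ in Filter.atTop, ∃ C : Finset (QWord q n),
        IsInsertionCoveringCode R C ∧
        (C.card : ℝ) ≤ K * ((R : ℝ) * Real.log R) * insertionSphereCoveringBound q n R) := by
  have key : ∀ q R : ℕ, 2 ≤ q → 2 ≤ R → ∀ T' > Real.exp 1 *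
      ((R : ℝ) * Real.log R + Real.sqrt (2 * (R : ℝ) * Real.log R) + 1),
      ∀ᶠ n : ℕ in Filter.atTop, insertionDensity q n R ≤ T' := by
    intro q R hq hR T' hT'
    obtain ⟨μ, h0, h1, h2⟩ := exists_density_parameter hR
    exact eventually_insertionDensity_le hq (by omega) h0 h1 (h2.trans_lt hT')
  -- With `a = R log R > 1`, the bracket is at most `a + 2a + a`, and `4e < 24`.
  refine ⟨fun q R hq hR => ⟨asymptoticInsertionDensity_one_lt_top hq, ?_⟩, 24, by norm_num, ?_⟩
  · have hlog : 0 ≤ Real.log R := Real.log_natCast_nonneg R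
    refine (asymptoticInsertionDensity_le (by positivity) (key q R hq hR)).trans ?_
    exact le_mul_of_one_le_right' (one_le_asymptoticInsertionDensity (by omega) 1)
  · intro q R hq hR
    have ha : 1 < (R : ℝ) * Real.log R := by
      have h1 : Real.log 2 ≤ Real.log R :=
        Real.log_le_log two_pos (by exact_mod_cast hR)
      have h2 : (2 : ℝ) ≤ R := by exact_mod_cast hR
      nlinarith [Real.log_two_gt_d9]
    have hs : Real.sqrt (2 * (R : ℝ) * Real.log R) ≤ 2 * ((R : ℝ) * Real.log R) :=
      Real.sqrt_le_iff.2 ⟨by linarith, by nlinarith⟩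
    have hT : Real.exp 1 * ((R : ℝ) * Real.log R + Real.sqrt (2 * (R : ℝ) * Real.log R) + 1)
        < 24 * ((R : ℝ) * Real.log R) := by
      have h1 := mul_le_mul_of_nonneg_left
        (show (R : ℝ) * Real.log R + Real.sqrt (2 * (R : ℝ) * Real.log R) + 1
          ≤ 4 * ((R : ℝ) * Real.log R) by linarith) (Real.exp_pos 1).le
      nlinarith [Real.exp_one_lt_d9]
    filter_upwards [key q R hq hR _ hT] with n hn
    obtain ⟨C, hC, hcard⟩ := exists_code_card_eq_minInsertionCovering q n R
    refine ⟨C, hC, ?_⟩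
    have hV : (0 : ℝ) < insertionBallSize q n R := by exact_mod_cast insertionBallSize_pos q n R
    have hq0 : (0 : ℝ) < (q : ℝ) ^ (n + R) := by positivity
    rw [insertionDensity, div_le_iff₀ hq0] at hn
    rw [hcard, insertionSphereCoveringBound, ← mul_div_assoc, le_div_iff₀ hV]
    exact hn
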